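/- Let $\alpha\ge 0$ be an integer, let $S_\alpha$ be the group of permutations of $\{1,\dots,\alpha\}$ (with product $(g_1g_2)(i)=g_1(g_2(i))$), and let $\nu\in\mathbb C$. Let $\mathbb O[\alpha;\nu]$ be the associative unital $\mathbb C$-algebra with generators $A(g)$, $g\in S_\alpha$, and $\Theta_1,\dots,\Theta_\alpha$, with unit $A(1)$, and with the relations $$A(g_1)A(g_2)=A(g_1g_2),\qquad A(g)\,\Theta_i\,A(g^{-1})=\Theta_{g(i)},\qquad \Theta_j^2=(\nu-1)\Theta_j+\nu A(1)$$ for all $g,g_1,g_2\in S_\alpha$ and $1\le i,j\le\alpha$, and $$\Theta_j\Theta_i-\Theta_i\Theta_j=A((ij))\,(\Theta_j-\Theta_i),\qquad \bigl(A((ij))-A(1)\bigr)\,\Theta_j\,(\Theta_i+A(1))=0$$ for all $i\ne j$, where $(ij)$ is the transposition of $i$ and $j$. Theorem. For every integer $\alpha\ge0$ and every $\nu\in\mathbb C$, the monomials $$A(g)\,\Theta_{i_1}\cdots\Theta_{i_k},\qquad k\ge 0,\quad g\in S_\alpha,\quad i_1<\dots<i_k,\quad g(i_1)<\dots<g(i_k),$$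 indexed by the pairs $(g,(i_1,\dots,i_k))$ satisfying these conditions, form a basis of the complex vector space $\mathbb O[\alpha;\nu]$. -/

import Mathlib

/-- Generators of the algebra: the symbols `A(g)`, for `g` a permutation of `α` letters, and
`Θ_i`, for `i` one of the `α` letters. -/
inductive InterpGen (α : ℕ) : Type
  | A (g : Equiv.Perm (Fin α)) : InterpGen α
  | Θ (i : Fin α) : InterpGen α

/-- The symbol `A(g)` in the free unital algebra. -/
noncomputable def freeA {α : ℕ} (g : Equiv.Perm (Fin α)) : FreeAlgebra ℂ (InterpGen α) :=
  FreeAlgebra.ι ℂ (InterpGen.A g)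

/-- The symbol `Θ_i` in the free unital algebra. -/
noncomputable def freeΘ {α : ℕ} (i : Fin α) : FreeAlgebra ℂ (InterpGen α) :=
  FreeAlgebra.ι ℂ (InterpGen.Θ i)

/-- The defining relations. The relation `one` says that the unit of the algebra is `A(1)`; in a
presentation without unit this is a consequence of the relations `mul` and `conj`. Permutations
are multiplied as functions, `(g₁ g₂)(i) = g₁(g₂(i))`. -/
inductive InterpRel (α : ℕ) (ν : ℂ) :
    FreeAlgebra ℂ (InterpGen α) → FreeAlgebra ℂ (InterpGen α) → Prop
  | one : InterpRel α ν (freeA 1) 1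
  | mul (g₁ g₂ : Equiv.Perm (Fin α)) :
      InterpRel α ν (freeA g₁ * freeA g₂) (freeA (g₁ * g₂))
  | conj (g : Equiv.Perm (Fin α)) (i : Fin α) :
      InterpRel α ν (freeA g * freeΘ i * freeA g⁻¹) (freeΘ (g i))
  | sq (j : Fin α) :
      InterpRel α ν (freeΘ j ^ 2) ((ν - 1) • freeΘ j + ν • freeA 1)
  | comm (i j : Fin α) (hij : i ≠ j) :
      InterpRel α ν (freeΘ j * freeΘ i - freeΘ i * freeΘ j)
        (freeA (Equiv.swap i j) * (freeΘ j - freeΘ i))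
  | absorb (i j : Fin α) (hij : i ≠ j) :
      InterpRel α ν ((freeA (Equiv.swap i j) - freeA 1) * freeΘ j * (freeΘ i + freeA 1)) 0

/-- The algebra `𝕆[α; ν]`. -/
abbrev InterpAlgebra (α : ℕ) (ν : ℂ) : Type := RingQuot (InterpRel α ν)

/-- The element `A(g)` of `𝕆[α; ν]`. -/
noncomputable def interpA {α : ℕ} (ν : ℂ) (g : Equiv.Perm (Fin α)) : InterpAlgebra α ν :=
  RingQuot.mkAlgHom ℂ (InterpRel α ν) (freeA g)

/-- The element `Θ_i` of `𝕆[α; ν]`. -/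
noncomputable def interpΘ {α : ℕ} (ν : ℂ) (i : Fin α) : InterpAlgebra α ν :=
  RingQuot.mkAlgHom ℂ (InterpRel α ν) (freeΘ i)

/-- The monomial `A(g) Θ_{i_1} ⋯ Θ_{i_k}`, where `l = [i_1, …, i_k]`. -/
noncomputable def interpMonomial {α : ℕ} (ν : ℂ) (g : Equiv.Perm (Fin α)) (l : List (Fin α)) :
    InterpAlgebra α ν :=
  interpA ν g * (l.map (interpΘ ν)).prod

/-- Pairs `(g, [i_1, …, i_k])`, `k ≥ 0`, with `i_1 < ⋯ < i_k` and `g(i_1) < ⋯ < g(i_k)`. -/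
abbrev InterpBasisIndex (α : ℕ) : Type :=
  {p : Equiv.Perm (Fin α) × List (Fin α) //
    p.2.Pairwise (· < ·) ∧ (p.2.map p.1).Pairwise (· < ·)}

/-! Spanning: filter by the number of factors `Θ`. Modulo fewer factors the `Θ_i` commute, a product
with a repeated factor vanishes, and `A((ij))` is absorbed by every product containing `Θ_i` and
`Θ_j`. So `g` matters only up to right multiplication by permutations of `{i_1, …, i_k}`, and some
representative is increasing on that set (`interpFiltration_le_span`).

Independence: if `ν + α` is a natural number, the algebra acts on functions of injections of the `α`
places into a set of `ν + α` elements, with `Θ_i` summing over the ways to move the `i`-th value to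
another unused element. Give `α` of the elements a colour each and the other `ν` the common colour
`none`. On functions of the colours alone, `Θ_i + 1` becomes `resample`, whose weight counts the
unused elements of a colour. This formula makes sense for every complex `ν`, and the relations are
checked directly.

Apply the monomials to the point mass at `some`. At a partial map with at least `k` undefined
places, a monomial with `k` factors `Θ` takes the value 1 or 0, whatever `ν` is
(`interpRep_monomial_apply`). The value 1 occurs only at `partialId l ∘ g⁻¹`, which determines `(g,
l)` (`partialId_comp_injective`), so the system is triangular. -/

section Spanning

/-! ### Straightening modulo shorter monomials. -/

variable {α : ℕ} {ν : ℂ}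

theorem interpA_one : interpA ν (1 : Equiv.Perm (Fin α)) = 1 := by
  rw [interpA, RingQuot.mkAlgHom_rel ℂ InterpRel.one, map_one]

theorem interpA_mul (g₁ g₂ : Equiv.Perm (Fin α)) :
    interpA ν g₁ * interpA ν g₂ = interpA ν (g₁ * g₂) := by
  rw [interpA, interpA, ← map_mul, RingQuot.mkAlgHom_rel ℂ (InterpRel.mul g₁ g₂), interpA]

theorem interpΘ_mul_interpA (g : Equiv.Perm (Fin α)) (i : Fin α) :
    interpΘ ν i * interpA ν g = interpA ν g * interpΘ ν (g⁻¹ i) := by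
  have h : interpA ν g * interpΘ ν (g⁻¹ i) * interpA ν g⁻¹ = interpΘ ν i := by
    rw [interpA, interpA, interpΘ, ← map_mul, ← map_mul,
      RingQuot.mkAlgHom_rel ℂ (InterpRel.conj g (g⁻¹ i)), interpΘ,
      show g (g⁻¹ i) = i by simp]
  rw [← h, mul_assoc _ (interpA ν g⁻¹), interpA_mul, inv_mul_cancel, interpA_one, mul_one]

theorem interpΘ_mul_self (j : Fin α) :
    interpΘ ν j * interpΘ ν j = (ν - 1) • interpΘ ν j + ν • 1 := by
  rw [← sq, ← interpA_one (ν := ν) (α := α), interpΘ, interpA, ← map_pow,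
    RingQuot.mkAlgHom_rel ℂ (InterpRel.sq j), map_add, map_smul, map_smul]

theorem interpΘ_comm {i j : Fin α} (hij : i ≠ j) :
    interpΘ ν j * interpΘ ν i - interpΘ ν i * interpΘ ν j =
      interpA ν (Equiv.swap i j) * (interpΘ ν j - interpΘ ν i) := by
  simp only [interpΘ, interpA, ← map_mul, ← map_sub]
  exact RingQuot.mkAlgHom_rel ℂ (InterpRel.comm i j hij)

theorem interp_absorb {i j : Fin α} (hij : i ≠ j) :
    (interpA ν (Equiv.swap i j) - 1) * interpΘ ν j * (interpΘ ν i + 1) = 0 := by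
  rw [← interpA_one (ν := ν) (α := α)]
  simp only [interpΘ, interpA, ← map_mul, ← map_sub, ← map_add]
  rw [RingQuot.mkAlgHom_rel ℂ (InterpRel.absorb i j hij), map_zero]

/-- The span of the monomials `A(g) Θ_{i_1} ⋯ Θ_{i_k}` with `k < n` and no further condition. -/
def interpFiltration (α : ℕ) (ν : ℂ) (n : ℕ) : Submodule ℂ (InterpAlgebra α ν) :=
  Submodule.span ℂ {a | ∃ g l, l.length < n ∧ interpMonomial ν g l = a}

theorem interpMonomial_mem_filtration {n : ℕ} (g : Equiv.Perm (Fin α)) {l : List (Fin α)}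
    (hl : l.length < n) : interpMonomial ν g l ∈ interpFiltration α ν n :=
  Submodule.subset_span ⟨g, l, hl, rfl⟩

theorem prod_mem_filtration {n : ℕ} {l : List (Fin α)} (hl : l.length < n) :
    (l.map (interpΘ ν)).prod ∈ interpFiltration α ν n := by
  simpa [interpMonomial, interpA_one] using interpMonomial_mem_filtration (ν := ν) 1 hl

theorem interpA_mul_monomial (h g : Equiv.Perm (Fin α)) (l : List (Fin α)) :
    interpA ν h * interpMonomial ν g l = interpMonomial ν (h * g) l := by
  rw [interpMonomial, ← mul_assoc, interpA_mul, interpMonomial]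

theorem interpΘ_mul_monomial (i : Fin α) (g : Equiv.Perm (Fin α)) (l : List (Fin α)) :
    interpΘ ν i * interpMonomial ν g l = interpMonomial ν g (g⁻¹ i :: l) := by
  rw [interpMonomial, ← mul_assoc, interpΘ_mul_interpA, interpMonomial, List.map_cons,
    List.prod_cons, mul_assoc]

theorem interpA_mul_mem_filtration {n : ℕ} (h : Equiv.Perm (Fin α)) {a : InterpAlgebra α ν}
    (ha : a ∈ interpFiltration α ν n) : interpA ν h * a ∈ interpFiltration α ν n := by
  induction ha using Submodule.span_induction with
  | mem a ha =>
    obtain ⟨g, l, hl, rfl⟩ := ha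
    rw [interpA_mul_monomial]
    exact interpMonomial_mem_filtration _ hl
  | zero => simp
  | add a b _ _ ha hb => rw [mul_add]; exact add_mem ha hb
  | smul c a _ ha => rw [mul_smul_comm]; exact Submodule.smul_mem _ _ ha

theorem interpΘ_mul_mem_filtration {n : ℕ} (i : Fin α) {a : InterpAlgebra α ν}
    (ha : a ∈ interpFiltration α ν n) : interpΘ ν i * a ∈ interpFiltration α ν (n + 1) := by
  induction ha using Submodule.span_induction with
  | mem a ha =>
    obtain ⟨g, l, hl, rfl⟩ := ha
    rw [interpΘ_mul_monomial]
    exact interpMonomial_mem_filtration _ (by simpa using hl)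
  | zero => simp
  | add a b _ _ ha hb => rw [mul_add]; exact add_mem ha hb
  | smul c a _ ha => rw [mul_smul_comm]; exact Submodule.smul_mem _ _ ha

/-- The commutator of two `Θ`s has only one factor `Θ` in each term. The bound in `interpFiltration`
is strict, so index `l.length` means an error of lower degree. -/
theorem prod_sub_prod_mem_filtration {l l' : List (Fin α)} (h : l.Perm l') :
    (l.map (interpΘ ν)).prod - (l'.map (interpΘ ν)).prod ∈ interpFiltration α ν l.length := by
  induction h with
  | nil => simp
  | cons x _ ih =>
    simp only [List.map_cons, List.prod_cons, ← mul_sub, List.length_cons]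
    exact interpΘ_mul_mem_filtration x ih
  | swap x y l =>
    by_cases hxy : x = y
    · subst hxy; simp
    · simp only [List.map_cons, List.prod_cons, ← mul_assoc, List.length_cons]
      rw [← sub_mul, interpΘ_comm hxy, mul_assoc, sub_mul]
      refine interpA_mul_mem_filtration _ (sub_mem ?_ ?_)
      · exact prod_mem_filtration (l := y :: l) (by simp)
      · exact prod_mem_filtration (l := x :: l) (by simp)
  | trans h₁ _ ih₁ ih₂ =>
    rw [← h₁.length_eq] at ih₂
    simpa using add_mem ih₁ ih₂

theorem prod_mem_filtration_of_not_nodup {l : List (Fin α)} (hl : ¬ l.Nodup) :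
    (l.map (interpΘ ν)).prod ∈ interpFiltration α ν l.length := by
  obtain ⟨i, hi⟩ : ∃ i, List.Duplicate i l := by
    by_contra! h
    exact hl (List.nodup_iff_forall_not_duplicate.2 h)
  obtain ⟨l', h'⟩ : ∃ l', l.Perm (i :: i :: l') := by
    obtain ⟨l', h'⟩ := (List.duplicate_iff_sublist.1 hi).exists_perm_append
    exact ⟨l', h'⟩
  rw [← sub_add_cancel (l.map (interpΘ ν)).prod ((i :: i :: l').map (interpΘ ν)).prod]
  refine add_mem (prod_sub_prod_mem_filtration h') ?_
  simp only [List.map_cons, List.prod_cons, ← mul_assoc]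
  rw [interpΘ_mul_self, add_mul, smul_mul_assoc, smul_mul_assoc, one_mul, h'.length_eq]
  refine add_mem (Submodule.smul_mem _ _ ?_) (Submodule.smul_mem _ _ ?_)
  · exact prod_mem_filtration (l := i :: l') (by simp)
  · exact prod_mem_filtration (by simp)

/-- With `s = A((ij))`, the last relation reads `(s - 1) Θ_j Θ_i = -(s - 1) Θ_j`, which has lower
degree. Reordering brings `Θ_j Θ_i` to the front. -/
theorem swap_mul_prod_sub_mem_filtration {l : List (Fin α)} {i j : Fin α} (hi : i ∈ l)
    (hj : j ∈ l) (hij : i ≠ j) :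
    interpA ν (Equiv.swap i j) * (l.map (interpΘ ν)).prod - (l.map (interpΘ ν)).prod ∈
      interpFiltration α ν l.length := by
  obtain ⟨l', h'⟩ : ∃ l', l.Perm (j :: i :: l') :=
    ⟨(l.erase j).erase i, (List.perm_cons_erase hj).trans
      ((List.perm_cons_erase ((List.mem_erase_of_ne hij).2 hi)).cons j)⟩
  have h1 := prod_sub_prod_mem_filtration (ν := ν) h'
  have h2 := interpA_mul_mem_filtration (Equiv.swap i j) h1
  have h3 : interpA ν (Equiv.swap i j) * ((j :: i :: l').map (interpΘ ν)).prod -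
      ((j :: i :: l').map (interpΘ ν)).prod ∈ interpFiltration α ν l.length := by
    have h4 : ((j :: l').map (interpΘ ν)).prod ∈ interpFiltration α ν l.length :=
      prod_mem_filtration (by simp [h'.length_eq])
    have h5 := sub_mem h4 (interpA_mul_mem_filtration (Equiv.swap i j) h4)
    convert h5 using 1
    have h6 := congrArg (· * (l'.map (interpΘ ν)).prod) (interp_absorb (ν := ν) hij)
    simp only [zero_mul] at h6
    rw [← sub_eq_zero, ← h6]
    simp only [List.map_cons, List.prod_cons, sub_mul, mul_add, add_mul, mul_one, one_mul,
      mul_assoc]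
    abel
  have h7 := sub_mem (add_mem h2 h3) h1
  rw [mul_sub] at h7
  convert h7 using 1
  abel

theorem ofSubtype_mul_prod_sub_mem_filtration {l : List (Fin α)}
    (h : Equiv.Perm {x // x ∈ l.toFinset}) :
    interpA ν (Equiv.Perm.ofSubtype h) * (l.map (interpΘ ν)).prod - (l.map (interpΘ ν)).prod ∈
      interpFiltration α ν l.length := by
  induction h using Equiv.Perm.swap_induction_on with
  | one => simp [interpA_one]
  | swap_mul f x y hxy ih =>
    have h1 := interpA_mul_mem_filtration (Equiv.swap (x : Fin α) y) ih
    have h2 := swap_mul_prod_sub_mem_filtration (ν := ν) (List.mem_toFinset.1 x.2)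
      (List.mem_toFinset.1 y.2) (Subtype.coe_injective.ne hxy)
    have h3 := add_mem h1 h2
    rw [map_mul, Equiv.Perm.ofSubtype_swap_eq, ← interpA_mul]
    rw [mul_sub, ← mul_assoc] at h3
    convert h3 using 1
    abel

theorem exists_pairwise_map_lt (g : Equiv.Perm (Fin α)) {l : List (Fin α)}
    (hl : l.Pairwise (· < ·)) :
    ∃ h : Equiv.Perm {x // x ∈ l.toFinset},
      (l.map (g * Equiv.Perm.ofSubtype h)).Pairwise (· < ·) := by
  let e := l.toFinset.orderIsoOfFin rfl
  -- Ranks in `l` are permuted so as to sort the values of `g`; `e` carries this back to the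
  -- letters.
  let σ := Tuple.sort fun k => g (e k)
  have hσ : Monotone fun k => g (e (σ k)) := Tuple.monotone_sort fun k => g (e k)
  refine ⟨e.symm.toEquiv.trans (σ.trans e.toEquiv), ?_⟩
  rw [List.pairwise_map]
  refine hl.imp_of_mem fun {a b} ha hb hab => ?_
  have ha' := List.mem_toFinset.2 ha
  have hb' := List.mem_toFinset.2 hb
  refine lt_of_le_of_ne ?_ ((Equiv.injective _).ne hab.ne)
  rw [Equiv.Perm.mul_apply, Equiv.Perm.mul_apply, Equiv.Perm.ofSubtype_apply_of_mem _ ha',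
    Equiv.Perm.ofSubtype_apply_of_mem _ hb']
  exact hσ (e.symm.monotone (show (⟨a, ha'⟩ : {x // x ∈ l.toFinset}) ≤ ⟨b, hb'⟩ from hab.le))

theorem interpFiltration_le_span (n : ℕ) :
    interpFiltration α ν n ≤ Submodule.span ℂ
      (Set.range fun p : InterpBasisIndex α => interpMonomial ν p.1.1 p.1.2) := by
  induction n with
  | zero =>
    refine Submodule.span_le.2 ?_
    rintro _ ⟨g, l, hl, rfl⟩
    exact absurd hl (Nat.not_lt_zero _)
  | succ n ih =>
    refine Submodule.span_le.2 ?_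
    rintro _ ⟨g, l, hl, rfl⟩
    rcases Nat.lt_succ_iff_lt_or_eq.1 hl with hl | rfl
    · exact ih (interpMonomial_mem_filtration g hl)
    by_cases hnd : l.Nodup
    · have hperm : l.Perm (l.mergeSort (· ≤ ·)) := (List.mergeSort_perm l _).symm
      have hsort : (l.mergeSort (· ≤ ·)).Pairwise (· < ·) := by
        have h1 : (l.mergeSort (· ≤ ·)).Pairwise (· ≤ ·) := List.pairwise_mergeSort' _ l
        exact (h1.and (hperm.nodup_iff.1 hnd)).imp fun h => lt_of_le_of_ne h.1 h.2
      generalize l.mergeSort (· ≤ ·) = l' at hperm hsort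
      obtain ⟨h, hh⟩ := exists_pairwise_map_lt g hsort
      have h1 := ih (interpA_mul_mem_filtration g (prod_sub_prod_mem_filtration (ν := ν) hperm))
      have h2 := ofSubtype_mul_prod_sub_mem_filtration (ν := ν) h
      rw [← hperm.length_eq] at h2
      have h3 := ih (interpA_mul_mem_filtration g h2)
      have h4 : interpMonomial ν (g * Equiv.Perm.ofSubtype h) l' ∈ Submodule.span ℂ
          (Set.range fun p : InterpBasisIndex α => interpMonomial ν p.1.1 p.1.2) :=
        Submodule.subset_span ⟨⟨(_, l'), hsort, hh⟩, rfl⟩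
      -- Sorting `l` into `l'` and then replacing `g` by `g h` each cost only shorter monomials.
      have h5 := add_mem h1 (sub_mem h4 h3)
      rw [← interpA_mul_monomial, interpMonomial, ← mul_sub, ← mul_add, sub_sub_cancel,
        sub_add_cancel] at h5
      exact h5
    · exact ih (interpA_mul_mem_filtration g (prod_mem_filtration_of_not_nodup hnd))

theorem exists_mem_filtration (a : InterpAlgebra α ν) : ∃ n, a ∈ interpFiltration α ν n := by
  have hmono : Monotone (interpFiltration α ν) := fun m n hmn =>
    Submodule.span_mono fun _ ⟨g, l, hl, h⟩ => ⟨g, l, hl.trans_le hmn, h⟩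
  have key : ∀ (w : FreeAlgebra ℂ (InterpGen α)) (n : ℕ), ∀ b ∈ interpFiltration α ν n,
      ∃ k, RingQuot.mkAlgHom ℂ (InterpRel α ν) w * b ∈ interpFiltration α ν k := by
    intro w
    induction w using FreeAlgebra.induction with
    | grade0 r =>
      intro n b hb
      refine ⟨n, ?_⟩
      rw [AlgHom.commutes, ← Algebra.smul_def]
      exact Submodule.smul_mem _ _ hb
    | grade1 x =>
      intro n b hb
      cases x with
      | A g => exact ⟨n, interpA_mul_mem_filtration g hb⟩
      | Θ i => exact ⟨n + 1, interpΘ_mul_mem_filtration i hb⟩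
    | mul v w hv hw =>
      intro n b hb
      obtain ⟨k, hk⟩ := hw n b hb
      rw [map_mul, mul_assoc]
      exact hv k _ hk
    | add v w hv hw =>
      intro n b hb
      obtain ⟨k, hk⟩ := hv n b hb
      obtain ⟨k', hk'⟩ := hw n b hb
      rw [map_add, add_mul]
      exact ⟨max k k', add_mem (hmono (le_max_left _ _) hk) (hmono (le_max_right _ _) hk')⟩
  obtain ⟨w, rfl⟩ := RingQuot.mkAlgHom_surjective ℂ (InterpRel α ν) a
  -- The unit is the empty product, of length 0 < 1.
  simpa using key w 1 1 (prod_mem_filtration (l := []) (by simp))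

theorem span_interpMonomial (α : ℕ) (ν : ℂ) :
    ⊤ ≤ Submodule.span ℂ
      (Set.range fun p : InterpBasisIndex α => interpMonomial ν p.1.1 p.1.2) := by
  intro a _
  obtain ⟨n, hn⟩ := exists_mem_filtration a
  exact interpFiltration_le_span n hn

end Spanning

section LinearIndependence

open Finset Function

/-! ### Resampling operators with arbitrary multiplicities. -/

section Representation

variable {α : ℕ} {Y : Type*}

/-- The action of permutations on functions by permuting places. -/
def permutePlaces (Y : Type*) (g : Equiv.Perm (Fin α)) : Module.End ℂ ((Fin α → Y) → ℂ) where
  toFun f x := f (x ∘ g)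
  map_add' _ _ := rfl
  map_smul' _ _ := rfl

theorem permutePlaces_apply (g : Equiv.Perm (Fin α)) (f : (Fin α → Y) → ℂ) (x : Fin α → Y) :
    permutePlaces Y g f x = f (x ∘ g) := rfl

variable [DecidableEq Y]

/-- The multiplicity `m y` minus the number of places `k ≠ i` with `x k = y`. -/
noncomputable def resampleWeight (m : Y → ℂ) (x : Fin α → Y) (i : Fin α) (y : Y) : ℂ :=
  m y - ∑ k ∈ univ.erase i, if x k = y then 1 else 0

/-- The operator that averages a function over the values at the place `i`, with weights
`resampleWeight`. -/
noncomputable def resample [Fintype Y] (m : Y → ℂ) (i : Fin α) : Module.End ℂ ((Fin α → Y) → ℂ) where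
  toFun f x := ∑ y, resampleWeight m x i y * f (update x i y)
  map_add' f g := by
    ext x
    simp [mul_add, sum_add_distrib]
  map_smul' c f := by
    ext x
    simp [mul_sum, mul_left_comm]

theorem resample_apply [Fintype Y] (m : Y → ℂ) (i : Fin α) (f : (Fin α → Y) → ℂ) (x : Fin α → Y) :
    resample m i f x = ∑ y, resampleWeight m x i y * f (update x i y) := rfl

theorem resampleWeight_update_self (m : Y → ℂ) (x : Fin α → Y) (i : Fin α) (y z : Y) :
    resampleWeight m (update x i y) i z = resampleWeight m x i z := by
  unfold resampleWeight
  congr 1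
  refine sum_congr rfl fun k hk => ?_
  rw [update_of_ne (ne_of_mem_erase hk)]

theorem resampleWeight_comp (m : Y → ℂ) (x : Fin α → Y) (g : Equiv.Perm (Fin α)) (i : Fin α)
    (y : Y) : resampleWeight m (x ∘ g) i y = resampleWeight m x (g i) y := by
  unfold resampleWeight
  congr 1
  refine sum_bij (fun k _ => g k) ?_ ?_ ?_ ?_
  · intro k hk
    simpa using hk
  · intro a _ b _ h
    exact g.injective h
  · intro b hb
    refine ⟨g.symm b, ?_, by simp⟩
    have := ne_of_mem_erase hb
    simp only [mem_erase, mem_univ, and_true]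
    rintro rfl
    simp at this
  · intro k _
    rfl

theorem sum_resampleWeight [Fintype Y] (m : Y → ℂ) (x : Fin α → Y) (i : Fin α) :
    ∑ y, resampleWeight m x i y = ∑ y, m y - (α - 1) := by
  unfold resampleWeight
  rw [sum_sub_distrib, sum_comm]
  have : 1 ≤ α := Fin.pos i
  simp [card_erase_of_mem, Nat.cast_sub this]

/-- A resampled function no longer depends on the value at `i`, and neither do the weights, so the
second resampling multiplies by the total weight. -/
theorem resample_mul_self [Fintype Y] (m : Y → ℂ) (i : Fin α) :
    resample m i * resample m i = (∑ y, m y - (α - 1)) • resample m i := by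
  refine LinearMap.ext fun f => funext fun x => ?_
  simp only [Module.End.mul_apply, LinearMap.smul_apply, Pi.smul_apply, smul_eq_mul]
  rw [resample_apply, ← sum_resampleWeight m x i, sum_mul]
  refine sum_congr rfl fun y _ => ?_
  congr 1
  simp only [resample_apply, resampleWeight_update_self, update_idem]

theorem permutePlaces_mul_resample [Fintype Y] (m : Y → ℂ) (g : Equiv.Perm (Fin α)) (i : Fin α) :
    permutePlaces Y g * resample m i = resample m (g i) * permutePlaces Y g := by
  refine LinearMap.ext fun f => funext fun x => ?_
  simp only [Module.End.mul_apply, resample_apply, permutePlaces_apply, resampleWeight_comp]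
  refine sum_congr rfl fun y _ => ?_
  congr 2
  ext k
  by_cases h : k = i
  · subst h; simp
  · simp [update_of_ne h, update_of_ne (g.injective.ne h)]

/-- The multiplicity `m y` minus the number of places other than `i` and `j` with value `y`. -/
noncomputable def pairWeight (m : Y → ℂ) (x : Fin α → Y) (i j : Fin α) (y : Y) : ℂ :=
  m y - ∑ k ∈ (univ.erase i).erase j, if x k = y then 1 else 0

theorem pairWeight_comm (m : Y → ℂ) (x : Fin α → Y) (i j : Fin α) (y : Y) :
    pairWeight m x i j y = pairWeight m x j i y := by
  rw [pairWeight, pairWeight, erase_right_comm]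

theorem resampleWeight_eq_pairWeight (m : Y → ℂ) (x : Fin α → Y) {i j : Fin α} (hij : i ≠ j)
    (y : Y) : resampleWeight m x i y = pairWeight m x i j y - if x j = y then 1 else 0 := by
  rw [resampleWeight, pairWeight, ← add_sum_erase (univ.erase i) _ (a := j) (by simp [hij.symm])]
  ring

theorem pairWeight_congr (m : Y → ℂ) {x x' : Fin α → Y} {i j : Fin α}
    (h : ∀ k, k ≠ i → k ≠ j → x k = x' k) (y : Y) :
    pairWeight m x i j y = pairWeight m x' i j y := by
  unfold pairWeight
  congr 1
  refine sum_congr rfl fun k hk => ?_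
  rw [h k (by simp at hk; tauto) (by simp at hk; tauto)]

theorem resample_resample_apply [Fintype Y] (m : Y → ℂ) {i j : Fin α} (hij : i ≠ j)
    (f : (Fin α → Y) → ℂ) (x : Fin α → Y) :
    resample m j (resample m i f) x =
      ∑ y, ∑ z, (pairWeight m x i j y - if x i = y then 1 else 0) *
        (pairWeight m x i j z - if y = z then 1 else 0) * f (update (update x j y) i z) := by
  rw [resample_apply]
  refine sum_congr rfl fun y _ => ?_
  rw [resample_apply, mul_sum]
  refine sum_congr rfl fun z _ => ?_
  rw [resampleWeight_eq_pairWeight m x hij.symm, pairWeight_comm m x j i,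
    resampleWeight_eq_pairWeight m _ hij, update_self, mul_assoc,
    pairWeight_congr m (x := update x j y) (x' := x) fun k _ h => update_of_ne h _ _]

theorem resample_comm [Fintype Y] (m : Y → ℂ) {i j : Fin α} (hij : i ≠ j) :
    resample m j * resample m i - resample m i * resample m j =
      permutePlaces Y (Equiv.swap i j) * (resample m j - resample m i) := by
  refine LinearMap.ext fun f => funext fun x => ?_
  simp only [Module.End.mul_apply, LinearMap.sub_apply, Pi.sub_apply, permutePlaces_apply]
  rw [resample_resample_apply m hij, resample_resample_apply m hij.symm, sum_comm (s := univ)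
    (f := fun y z => (pairWeight m x j i y - if x j = y then (1 : ℂ) else 0) *
        (pairWeight m x j i z - if y = z then 1 else 0) * f (update (update x i y) j z))]
  have h1 : ∀ y, update (x ∘ Equiv.swap i j) j y = update (update x j y) i (x j) := by
    intro y
    ext k
    by_cases hi : k = i
    · subst hi; simp [hij]
    · by_cases hj : k = j
      · subst hj; simp [hi]
      · simp [hi, hj, Equiv.swap_apply_of_ne_of_ne]
  have h2 : ∀ z, update (x ∘ Equiv.swap i j) i z = update (update x j (x i)) i z := by
    intro y
    ext k
    by_cases hi : k = i
    · subst hi; simp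
    · by_cases hj : k = j
      · subst hj; simp [hi]
      · simp [hi, hj, Equiv.swap_apply_of_ne_of_ne]
  rw [resample_apply, resample_apply]
  simp only [resampleWeight_comp, Equiv.swap_apply_left, Equiv.swap_apply_right, h1, h2,
    resampleWeight_eq_pairWeight m x hij, resampleWeight_eq_pairWeight m x hij.symm,
    pairWeight_comm m x j i, update_comm hij]
  generalize pairWeight m x i j = W
  generalize x i = a
  generalize x j = b
  rw [← sum_sub_distrib]
  -- Here `y` is the new value at `j` and `z` the one at `i`. The terms `W y * W z` and the diagonal
  -- terms `y = z` cancel; what is left comes from the old values `a` and `b`.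
  have key : ∀ F : Y → Y → ℂ,
      ∑ y, ∑ z, (W y - if a = y then 1 else 0) * (W z - if y = z then 1 else 0) * F y z -
      ∑ y, ∑ z, (W z - if b = z then 1 else 0) * (W y - if z = y then 1 else 0) * F y z =
      ∑ y, (W y - if b = y then 1 else 0) * F y b -
      ∑ z, (W z - if a = z then 1 else 0) * F a z := by
    intro F
    have hc : ∑ y, ∑ z, W z * W y * F y z = ∑ y, ∑ z, W y * W z * F y z :=
      sum_congr rfl fun _ _ => sum_congr rfl fun _ _ => by ring
    simp [sub_mul, mul_sub, sum_sub_distrib, ite_mul, mul_ite, hc]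
    ring
  simpa [sum_sub_distrib] using key fun y z => f (update (update x j y) i z)

theorem resample_absorb [Fintype Y] (m : Y → ℂ) {i j : Fin α} (hij : i ≠ j) :
    (permutePlaces Y (Equiv.swap i j) - 1) * (resample m j - 1) * resample m i = 0 := by
  -- Subtracting 1 from `resample m j` makes the weight symmetric in `x i` and `x j`. Both values
  -- are then overwritten, so exchanging them changes nothing.
  have key : ∀ (f : (Fin α → Y) → ℂ) (x : Fin α → Y),
      ((resample m j - 1) * resample m i) f x =
      ∑ y, ∑ z, (pairWeight m x i j y - (if x i = y then 1 else 0) - if x j = y then 1 else 0) *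
        (pairWeight m x i j z - if y = z then 1 else 0) * f (update (update x j y) i z) := by
    intro f x
    simp only [Module.End.mul_apply, LinearMap.sub_apply, Pi.sub_apply, Module.End.one_apply]
    rw [resample_resample_apply m hij, resample_apply]
    simp only [resampleWeight_eq_pairWeight m x hij]
    have : ∑ z, (pairWeight m x i j z - if x j = z then 1 else 0) * f (update x i z) =
        ∑ y, ∑ z, (if x j = y then 1 else 0) * (pairWeight m x i j z - if y = z then 1 else 0) *
          f (update (update x j y) i z) := by
      rw [sum_comm]
      simp [ite_mul]
    rw [this, ← sum_sub_distrib]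
    refine sum_congr rfl fun y _ => ?_
    rw [← sum_sub_distrib]
    refine sum_congr rfl fun z _ => ?_
    ring
  refine LinearMap.ext fun f => funext fun x => ?_
  rw [mul_assoc, sub_mul, one_mul, LinearMap.sub_apply, Pi.sub_apply, Module.End.mul_apply,
    permutePlaces_apply, key, key, LinearMap.zero_apply, Pi.zero_apply, sub_eq_zero]
  refine sum_congr rfl fun y _ => sum_congr rfl fun z _ => ?_
  have hk : ∀ k, k ≠ i → k ≠ j → (x ∘ Equiv.swap i j) k = x k := fun k hi hj => by
    simp [Equiv.swap_apply_of_ne_of_ne hi hj]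
  have hu : update (update (x ∘ Equiv.swap i j) j y) i z = update (update x j y) i z := by
    ext k
    by_cases hi : k = i
    · subst hi; simp
    · by_cases hj : k = j
      · subst hj; simp [hi]
      · simp [hi, hj, Equiv.swap_apply_of_ne_of_ne]
  simp only [pairWeight_congr m hk, hu]
  simp only [comp_apply, Equiv.swap_apply_left, Equiv.swap_apply_right]
  ring

end Representation

/-! ### The representation on functions of partial maps. -/

/-- The multiplicities on partial values: `ν` for an undefined value, `1` for every other one. -/
def partialMultiplicity (α : ℕ) (ν : ℂ) (y : Option (Fin α)) : ℂ :=
  y.elim ν fun _ => 1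

/-- The images of the generators in the representation on functions of partial maps. -/
noncomputable def interpGenRep (α : ℕ) (ν : ℂ) :
    InterpGen α → Module.End ℂ ((Fin α → Option (Fin α)) → ℂ)
  | .A g => permutePlaces _ g
  | .Θ i => resample (partialMultiplicity α ν) i - 1

theorem lift_freeA {α : ℕ} (ν : ℂ) (g : Equiv.Perm (Fin α)) :
    FreeAlgebra.lift ℂ (interpGenRep α ν) (freeA g) = permutePlaces _ g :=
  FreeAlgebra.lift_ι_apply ..

theorem lift_freeΘ {α : ℕ} (ν : ℂ) (i : Fin α) :
    FreeAlgebra.lift ℂ (interpGenRep α ν) (freeΘ i) =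
      resample (partialMultiplicity α ν) i - 1 :=
  FreeAlgebra.lift_ι_apply ..

theorem lift_interpGenRep_eq {α : ℕ} {ν : ℂ} {a b : FreeAlgebra ℂ (InterpGen α)}
    (h : InterpRel α ν a b) :
    FreeAlgebra.lift ℂ (interpGenRep α ν) a = FreeAlgebra.lift ℂ (interpGenRep α ν) b := by
  have hone : permutePlaces (Option (Fin α)) (1 : Equiv.Perm (Fin α)) = 1 := rfl
  induction h with
  | one => rw [lift_freeA, map_one, hone]
  | mul g₁ g₂ => simp only [map_mul, lift_freeA]; rfl
  | conj g i =>
    simp only [map_mul, lift_freeA, lift_freeΘ, mul_sub, sub_mul, permutePlaces_mul_resample,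
      mul_one]
    have : permutePlaces (Option (Fin α)) g * permutePlaces _ g⁻¹ = 1 := by
      rw [← hone, ← mul_inv_cancel g]; rfl
    rw [mul_assoc, this, mul_one]
  | sq j =>
    -- The multiplicities add up to `ν + α`, so `(Θ_j + 1)² = (ν + 1)(Θ_j + 1)`.
    have hs : ∑ y, partialMultiplicity α ν y - ((α : ℂ) - 1) = ν + 1 := by
      simp [partialMultiplicity, Fintype.sum_option]
      ring
    have := resample_mul_self (partialMultiplicity α ν) j
    rw [hs] at this
    rw [map_pow, map_add, map_smul, map_smul, lift_freeA, lift_freeΘ, hone, sq, sub_mul, mul_sub,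
      this, mul_one, one_mul]
    module
  | comm i j hij =>
    have := resample_comm (partialMultiplicity α ν) hij
    simp only [map_mul, map_sub, lift_freeA, lift_freeΘ]
    rw [sub_sub_sub_cancel_right, ← this]
    simp only [sub_mul, mul_sub, one_mul, mul_one]
    abel
  | absorb i j hij =>
    have := resample_absorb (partialMultiplicity α ν) hij
    simpa only [map_mul, map_sub, map_add, map_zero, lift_freeA, lift_freeΘ, hone,
      sub_add_cancel] using this

/-- The representation of `𝕆[α; ν]` on functions of partial maps. -/
noncomputable def interpRep (α : ℕ) (ν : ℂ) :
    InterpAlgebra α ν →ₐ[ℂ] Module.End ℂ ((Fin α → Option (Fin α)) → ℂ) :=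
  RingQuot.liftAlgHom ℂ ⟨FreeAlgebra.lift ℂ (interpGenRep α ν), fun _ _ => lift_interpGenRep_eq⟩

theorem interpRep_A {α : ℕ} (ν : ℂ) (g : Equiv.Perm (Fin α)) :
    interpRep α ν (interpA ν g) = permutePlaces _ g := by
  rw [interpRep, interpA, RingQuot.liftAlgHom_mkAlgHom_apply, lift_freeA]

theorem interpRep_Θ {α : ℕ} (ν : ℂ) (i : Fin α) :
    interpRep α ν (interpΘ ν i) = resample (partialMultiplicity α ν) i - 1 := by
  rw [interpRep, interpΘ, RingQuot.liftAlgHom_mkAlgHom_apply, lift_freeΘ]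

/-! ### Triangularity at the point mass. -/

/-- The identity with the places in `l` made undefined. -/
def partialId {α : ℕ} (l : List (Fin α)) (k : Fin α) : Option (Fin α) :=
  if k ∈ l then none else some k

theorem partialId_eq_none {α : ℕ} {l : List (Fin α)} {k : Fin α} :
    partialId l k = none ↔ k ∈ l := by
  simp [partialId]

theorem partialId_eq_some {α : ℕ} {l : List (Fin α)} {k a : Fin α} :
    partialId l k = some a ↔ k ∉ l ∧ k = a := by
  simp [partialId]

/-- The set of undefined places. -/
def undefinedPlaces {α : ℕ} (x : Fin α → Option (Fin α)) : Finset (Fin α) :=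
  univ.filter fun k => x k = none

theorem undefinedPlaces_subset_insert {α : ℕ} (x : Fin α → Option (Fin α)) (i : Fin α)
    (y : Option (Fin α)) : undefinedPlaces x ⊆ insert i (undefinedPlaces (update x i y)) := by
  intro k hk
  by_cases h : k = i
  · simp [h]
  · simpa [undefinedPlaces, h] using hk

theorem card_undefinedPlaces_le {α : ℕ} (x : Fin α → Option (Fin α)) (i : Fin α)
    (y : Option (Fin α)) :
    (undefinedPlaces x).card ≤ (undefinedPlaces (update x i y)).card + 1 :=
  (card_le_card (undefinedPlaces_subset_insert x i y)).trans (card_insert_le _ _)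

theorem card_undefinedPlaces_le_of_ne_none {α : ℕ} {x : Fin α → Option (Fin α)} {i : Fin α}
    (hx : x i ≠ none) (y : Option (Fin α)) :
    (undefinedPlaces x).card ≤ (undefinedPlaces (update x i y)).card := by
  refine card_le_card fun k hk => ?_
  have h : k ≠ i := by
    rintro rfl
    simp [undefinedPlaces, hx] at hk
  simpa [undefinedPlaces, h] using hk

theorem card_undefinedPlaces_partialId {α : ℕ} {l : List (Fin α)} (hl : l.Nodup) :
    (undefinedPlaces (partialId l)).card = l.length := by
  rw [← List.toFinset_card_of_nodup hl]
  congr 1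
  ext k
  simp [undefinedPlaces, partialId_eq_none]

theorem interpRep_Θ_apply {α : ℕ} (ν : ℂ) (i : Fin α) (f : (Fin α → Option (Fin α)) → ℂ)
    (x : Fin α → Option (Fin α)) :
    interpRep α ν (interpΘ ν i) f x =
      ∑ y, (resampleWeight (partialMultiplicity α ν) x i y - if x i = y then 1 else 0) *
        f (update x i y) := by
  rw [interpRep_Θ]
  simp [sub_mul, sum_sub_distrib, resample_apply]

/-- Each `Θ_i` fills at most one undefined place, so under `hx` every factor must fill one. Place
`i` can only be filled with `some i`, and this has coefficient 1 because no place holds `some i`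
yet. The weight `ν` of `none` never enters. -/
theorem interpRep_prod_apply {α : ℕ} (ν : ℂ) (l : List (Fin α)) (hl : l.Nodup)
    (x : Fin α → Option (Fin α)) (hx : l.length ≤ (undefinedPlaces x).card) :
    interpRep α ν (l.map (interpΘ ν)).prod (Pi.single some 1) x =
      if x = partialId l then 1 else 0 := by
  induction l generalizing x with
  | nil =>
    have : partialId ([] : List (Fin α)) = some := by ext k; simp [partialId]
    simp [this, Pi.single_apply]
  | cons i l ih =>
    obtain ⟨hi, hl⟩ := List.nodup_cons.1 hl
    rw [List.length_cons] at hx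
    rw [List.map_cons, List.prod_cons, map_mul, Module.End.mul_apply, interpRep_Θ_apply]
    have hle := card_undefinedPlaces_le x i
    rw [sum_congr rfl fun y _ => by
      rw [ih hl (update x i y) (by have := hle y; omega)]]
    by_cases hxl : x = partialId (i :: l)
    · have hxi : x i = none := by simp [hxl, partialId]
      have hu : ∀ y, update x i y = partialId l ↔ y = some i := by
        intro y
        constructor
        · intro h
          have := congrFun h i
          simpa [partialId, hi] using this
        · rintro rfl
          ext k
          by_cases h : k = i
          · subst h; simp [partialId, hi]
          · simp [h, hxl, partialId]
      simp only [hu, mul_ite, mul_one, mul_zero, sum_ite_eq', mem_univ, if_true]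
      have hne : ∀ k, x k ≠ some i := by
        intro k h
        rw [hxl] at h
        obtain ⟨h1, rfl⟩ := partialId_eq_some.1 h
        simp at h1
      rw [if_pos hxl]
      simp [resampleWeight, hne, partialMultiplicity]
    · rw [if_neg hxl]
      refine sum_eq_zero fun y _ => ?_
      suffices h : update x i y ≠ partialId l by rw [if_neg h, mul_zero]
      intro h
      have hc : (undefinedPlaces (update x i y)).card = l.length := by
        rw [h, card_undefinedPlaces_partialId hl]
      by_cases hxi : x i = none
      · apply hxl
        ext1 k
        by_cases hk : k = i
        · subst hk; simp [hxi, partialId]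
        · have := congrFun h k
          rw [update_of_ne hk] at this
          simp [this, partialId, hk]
      -- Changing a defined place leaves more than `l.length` undefined places.
      · have := card_undefinedPlaces_le_of_ne_none hxi y
        omega

theorem card_undefinedPlaces_comp {α : ℕ} (x : Fin α → Option (Fin α))
    (g : Equiv.Perm (Fin α)) :
    (undefinedPlaces (x ∘ g)).card = (undefinedPlaces x).card := by
  refine card_bij (fun k _ => g k) ?_ (fun _ _ _ _ h => g.injective h) ?_
  · intro k hk
    simpa [undefinedPlaces] using hk
  · intro k hk
    exact ⟨g⁻¹ k, by simpa [undefinedPlaces] using hk, by simp⟩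

theorem interpRep_monomial_apply {α : ℕ} (ν : ℂ) (g : Equiv.Perm (Fin α)) (l : List (Fin α))
    (hl : l.Nodup) (x : Fin α → Option (Fin α)) (hx : l.length ≤ (undefinedPlaces x).card) :
    interpRep α ν (interpMonomial ν g l) (Pi.single some 1) x =
      if x ∘ g = partialId l then 1 else 0 := by
  rw [interpMonomial, map_mul, Module.End.mul_apply, interpRep_A, permutePlaces_apply,
    interpRep_prod_apply ν l hl _ (by rwa [card_undefinedPlaces_comp])]

/-- The hypothesis says that `partialId l ∘ g⁻¹` is the same for both pairs. It records `l` through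
the missing values, and `g` off `l`. On `l`, `g` is the only increasing bijection onto the remaining
letters. -/
theorem partialId_comp_injective {α : ℕ} {p q : InterpBasisIndex α}
    (h : partialId p.1.2 ∘ ⇑(p.1.1⁻¹ * q.1.1) = partialId q.1.2) : p = q := by
  obtain ⟨⟨g, l⟩, hl, hgl⟩ := p
  obtain ⟨⟨g', l'⟩, hl', hgl'⟩ := q
  dsimp only at h hl hgl hl' hgl'
  have h1 : ∀ a, a ∉ l' → a ∉ l ∧ g' a = g a := by
    intro a ha
    have h2 := congrFun h a
    rw [partialId_eq_some.2 ⟨ha, rfl⟩, comp_apply, partialId_eq_some, Equiv.Perm.mul_apply,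
      Equiv.Perm.inv_eq_iff_eq] at h2
    refine ⟨?_, h2.2⟩
    rw [h2.2] at h2
    simpa using h2.1
  have hcard : l.length = l'.length := by
    have h2 := congrArg (Finset.card <| undefinedPlaces ·) h
    rwa [card_undefinedPlaces_comp, card_undefinedPlaces_partialId hl.nodup, card_undefinedPlaces_partialId hl'.nodup] at h2
  have hsub : l ⊆ l' := fun a ha => by
    by_contra hn
    exact (h1 a hn).1 ha
  have hperm : l.Perm l' :=
    (List.subperm_of_subset hl.nodup hsub).perm_of_length_le hcard.ge
  obtain rfl : l = l' := hperm.eq_of_pairwise (fun a b _ _ h1 h2 => absurd h1 h2.asymm) hl hl'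
  have hsub' : l.map g' ⊆ l.map g := by
    intro b hb
    obtain ⟨a, ha, rfl⟩ := List.mem_map.1 hb
    by_contra hn
    have h3 : g⁻¹ (g' a) ∉ l := fun h4 => hn (List.mem_map.2 ⟨_, h4, by simp⟩)
    have h4 := (h1 _ h3).2
    rw [show g (g⁻¹ (g' a)) = g' a by simp] at h4
    rw [g'.injective h4] at h3
    exact h3 ha
  have hperm' : (l.map g').Perm (l.map g) :=
    (List.subperm_of_subset hgl'.nodup hsub').perm_of_length_le (by simp)
  have hmap := hperm'.eq_of_pairwise (fun a b _ _ h1 h2 => absurd h1 h2.asymm) hgl' hgl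
  have hg : g = g' := by
    ext a
    by_cases ha : a ∈ l
    · rw [List.map_inj_left.1 hmap a ha]
    · rw [(h1 a ha).2]
  rw [Subtype.mk.injEq, hg]

theorem linearIndependent_interpMonomial (α : ℕ) (ν : ℂ) :
    LinearIndependent ℂ fun p : InterpBasisIndex α => interpMonomial ν p.1.1 p.1.2 := by
  rw [linearIndependent_iff]
  intro c hc
  -- A longest monomial with nonzero coefficient is isolated by evaluating at its own partial map;
  -- all others in the support are short enough for `interpRep_monomial_apply` and give 0.
  by_contra hne
  obtain ⟨p, hp, hmax⟩ := c.support.exists_max_image (fun p => p.1.2.length)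
    (Finsupp.support_nonempty_iff.2 hne)
  have hx : (undefinedPlaces (partialId p.1.2 ∘ ⇑(p.1.1)⁻¹)).card = p.1.2.length := by
    rw [card_undefinedPlaces_comp, card_undefinedPlaces_partialId p.2.1.nodup]
  have h := congrFun (LinearMap.congr_fun (congrArg (interpRep α ν) hc) (Pi.single some 1))
    (partialId p.1.2 ∘ ⇑(p.1.1)⁻¹)
  rw [Finsupp.linearCombination_apply, Finsupp.sum, map_sum, LinearMap.sum_apply,
    Finset.sum_apply, map_zero, LinearMap.zero_apply, Pi.zero_apply, sum_eq_single p] at h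
  · rw [map_smul, LinearMap.smul_apply, Pi.smul_apply,
      interpRep_monomial_apply _ _ _ p.2.1.nodup _ hx.ge, if_pos, smul_eq_mul, mul_one] at h
    · exact Finsupp.mem_support_iff.1 hp h
    · ext1 k
      simp
  · intro q hq hqp
    rw [map_smul, LinearMap.smul_apply, Pi.smul_apply,
      interpRep_monomial_apply _ _ _ q.2.1.nodup _ (by rw [hx]; exact hmax q hq), if_neg,
      smul_zero]
    exact fun h => hqp (partialId_comp_injective h).symm
  · exact fun h => absurd hp h

end LinearIndependence

theorem mainTheorem2 (α : ℕ) (ν : ℂ) :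
    ∃ b : Module.Basis (InterpBasisIndex α) ℂ (InterpAlgebra α ν),
      ∀ p : InterpBasisIndex α, b p = interpMonomial ν p.1.1 p.1.2 := by
  exact ⟨Module.Basis.mk (linearIndependent_interpMonomial α ν) (span_interpMonomial α ν),
    fun p => Module.Basis.mk_apply _ _ p⟩
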